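/- Lemma 2.5. Let $f:\mathbb{C}\to\mathbb{C}$ be a transcendental entire function (that is, entire and not a polynomial) of order at most one, where the order of $f$ is $\limsup_{r\to\infty}\frac{\log\log M(r,f)}{\log r}$ with $M(r,f)=\max_{|z|=r}|f(z)|$, and let $b$ be a nonzero complex number. (a) Let $S$ be a finite subset of $\mathbb{C}$ such that for all $z\in\mathbb{C}$, $f(z)=b$ implies $f'(z)\in S$. Then for every nonzero $c\in\mathbb{C}$ there are infinitely many $z\in\mathbb{C}$ with $f'(z)=c$. (b) Suppose that for all $z\in\mathbb{C}$, $f'(z)=b$ implies $f(z)=b$, and let $a\in\mathbb{C}$ be such that there are only finitely many $z\in\mathbb{C}$ with $f(z)=a$. Then $a\neq b$, and there is a nonzero constant $C\in\mathbb{C}$ such that $f(z)=Ce^{\frac{b}{b-a}z}+a$ for all $z\in\mathbb{C}$. -/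

import Mathlib

open Filter

/-- An entire function: complex differentiable on the whole plane. It is transcendental if it is
not (the function of) a polynomial. -/
def IsTranscendentalEntire (f : ℂ → ℂ) : Prop :=
  Differentiable ℂ f ∧ ¬ ∃ p : Polynomial ℂ, ∀ z, f z = p.eval z

/-- The maximum modulus `M(r, f) = max_{|z| = r} |f z|` (for continuous `f` and `0 ≤ r` the
supremum is a maximum over a nonempty compact set). -/
noncomputable def maxModulus (f : ℂ → ℂ) (r : ℝ) : ℝ :=
  sSup ((fun z => ‖f z‖) '' Metric.sphere (0 : ℂ) r)

/-- The order of an entire function,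
`ρ(f) = limsup_{r → ∞} log log M(r, f) / log r`, as an extended real number.
(For nonconstant `f` one has `M(r, f) > e` for all large `r`, so that the logarithms are the
usual ones; for constant `f` the value is `0`, the usual convention.) -/
noncomputable def entireOrder (f : ℂ → ℂ) : EReal :=
  limsup (fun r : ℝ => ((Real.log (Real.log (maxModulus f r)) / Real.log r : ℝ) : EReal)) atTop

open Asymptotics Topology Polynomial

/-! Order at most one gives growth `exp (o(|z|²))`; with finitely many zeros this forces the form `P
e^{lz}` (`exists_eq_polynomial_mul_exp`).

(a) If `f' = c` only finitely often, then `f' = c + P e^{lz}`, hence `f = cz + d + Q e^{lz}` with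
`Q' + lQ = P` and `l ≠ 0`. By `infinite_zeros_polynomial_mul_exp_add`, `f` has infinitely many
`b`-points, and `f'` takes a single value `s ∈ S` at infinitely many of them. Eliminating `e^{lz}`
there gives `P (cz + d - b) = (c - s) Q`, impossible as `deg P = deg Q`.

(b) Here `f = a + P e^{lz}`, and `f'` has infinitely many `b`-points. Elimination gives `(b - a)(P'
+ lP) = bP`, so `P` is constant and `l = b / (b - a)`. -/

/-! ### Factoring out finitely many zeros. -/

theorem exists_eq_pow_mul_of_finite_zeros {g : ℂ → ℂ} (hg : Differentiable ℂ g)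
    (hfin : {z | g z = 0}.Finite) (w : ℂ) :
    ∃ (n : ℕ) (h : ℂ → ℂ), Differentiable ℂ h ∧ h w ≠ 0 ∧ ∀ z, g z = (z - w) ^ n * h z := by
  have han : AnalyticAt ℂ g w := hg.analyticAt w
  have hne : ¬ ∀ᶠ z in 𝓝 w, g z = 0 := fun h => infinite_of_mem_nhds w h hfin
  obtain ⟨n, k, hk, hkw, hgk⟩ := han.exists_eventuallyEq_pow_smul_nonzero_iff.mpr hne
  set h : ℂ → ℂ := fun z => if z = w then k w else g z / (z - w) ^ n with hdef
  have heq : h =ᶠ[𝓝 w] k := by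
    filter_upwards [hgk] with z hz
    by_cases hzw : z = w
    · simp [hdef, hzw]
    · have : (z - w) ^ n ≠ 0 := pow_ne_zero _ (sub_ne_zero.mpr hzw)
      simp only [hdef, if_neg hzw, hz, smul_eq_mul]
      field_simp
  refine ⟨n, h, fun z => ?_, by simpa [hdef] using hkw, fun z => ?_⟩
  · by_cases hzw : z = w
    · subst hzw
      exact (heq.symm.differentiableAt_iff).mp hk.differentiableAt
    · have h2 : h =ᶠ[𝓝 z] fun z => g z / (z - w) ^ n := by
        filter_upwards [isOpen_ne.mem_nhds hzw] with y hy
        simp only [hdef]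
        exact if_neg hy
      rw [h2.differentiableAt_iff]
      exact (hg z).div (by fun_prop) (pow_ne_zero _ (sub_ne_zero.mpr hzw))
  · by_cases hzw : z = w
    · subst hzw
      simpa [hdef] using hgk.self_of_nhds
    · have : (z - w) ^ n ≠ 0 := pow_ne_zero _ (sub_ne_zero.mpr hzw)
      simp only [hdef, if_neg hzw]
      field_simp

theorem exists_eq_monic_mul_of_finite_zeros {g : ℂ → ℂ} (hg : Differentiable ℂ g)
    (hfin : {z | g z = 0}.Finite) :
    ∃ (P : ℂ[X]) (h : ℂ → ℂ), P.Monic ∧ Differentiable ℂ h ∧ (∀ z, h z ≠ 0) ∧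
      ∀ z, g z = P.eval z * h z := by
  suffices H : ∀ (s : Finset ℂ) (g : ℂ → ℂ), Differentiable ℂ g → (∀ z, g z = 0 → z ∈ s) →
      ∃ (P : ℂ[X]) (h : ℂ → ℂ), P.Monic ∧ Differentiable ℂ h ∧ (∀ z, h z ≠ 0) ∧
      ∀ z, g z = P.eval z * h z from
    H hfin.toFinset g hg (by simp)
  intro s
  induction s using Finset.induction_on with
  | empty =>
    intro g hg hz
    exact ⟨1, g, monic_one, hg, fun z h => by simpa using hz z h, by simp⟩
  | insert w s hw ih =>
    intro g hg hz
    obtain ⟨n, h, hh, hhw, hgh⟩ := exists_eq_pow_mul_of_finite_zeros hg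
      ((insert w s).finite_toSet.subset hz) w
    obtain ⟨P, k, hP, hk, hk0, hhk⟩ := ih h hh fun z h0 => by
      have := hz z (by simp [hgh, h0])
      rcases Finset.mem_insert.mp this with rfl | h1
      · exact absurd h0 hhw
      · exact h1
    refine ⟨(X - C w) ^ n * P, k, ((monic_X_sub_C w).pow n).mul hP, hk, hk0, fun z => ?_⟩
    rw [hgh, hhk]
    simp [mul_assoc]

theorem exists_eq_exp {h : ℂ → ℂ} (hh : Differentiable ℂ h) (h0 : ∀ z, h z ≠ 0) :
    ∃ k : ℂ → ℂ, Differentiable ℂ k ∧ ∀ z, h z = Complex.exp (k z) := by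
  have hd : Differentiable ℂ (fun z => deriv h z / h z) := hh.deriv.div hh h0
  obtain ⟨k, hk⟩ := hd.isExactOn_univ
  have hk' : ∀ z, HasDerivAt k (deriv h z / h z) z := fun z => hk z (Set.mem_univ z)
  have hconst : ∀ z, h z * Complex.exp (-k z) = h 0 * Complex.exp (-k 0) := by
    refine fun z => is_const_of_deriv_eq_zero (f := fun z => h z * Complex.exp (-k z))
      (hh.mul fun z => ((hk' z).neg.cexp).differentiableAt) (fun z => ?_) z 0
    refine ((hh z).hasDerivAt.mul (hk' z).neg.cexp).deriv.trans ?_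
    have := h0 z
    simp only [Pi.neg_apply]
    field_simp
    ring
  have hne : h 0 * Complex.exp (-k 0) ≠ 0 := mul_ne_zero (h0 0) (Complex.exp_ne_zero _)
  refine ⟨fun z => Complex.log (h 0 * Complex.exp (-k 0)) + k z,
    fun z => ((hk' z).const_add _).differentiableAt, fun z => ?_⟩
  rw [Complex.exp_add, Complex.exp_log hne, ← hconst z, mul_assoc, ← Complex.exp_add]
  simp

/-! ### Growth classes and Hadamard factorization. -/

/-- Growth of order at most two and type zero: `log⁺ ‖g z‖ = o(‖z‖ ^ 2)`. -/
def SubgaussianGrowth (g : ℂ → ℂ) : Prop :=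
  ∀ ε : ℝ, 0 < ε → g =O[cocompact ℂ] fun z => Real.exp (ε * ‖z‖ ^ 2)

namespace SubgaussianGrowth

variable {g h : ℂ → ℂ}

theorem add (hg : SubgaussianGrowth g) (hh : SubgaussianGrowth h) :
    SubgaussianGrowth fun z => g z + h z := fun ε hε => (hg ε hε).add (hh ε hε)

theorem sub (hg : SubgaussianGrowth g) (hh : SubgaussianGrowth h) :
    SubgaussianGrowth fun z => g z - h z := fun ε hε => (hg ε hε).sub (hh ε hε)

theorem mul (hg : SubgaussianGrowth g) (hh : SubgaussianGrowth h) :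
    SubgaussianGrowth fun z => g z * h z := fun ε hε => by
  refine ((hg _ (half_pos hε)).mul (hh _ (half_pos hε))).congr_right fun z => ?_
  rw [← Real.exp_add]
  ring_nf

theorem const (c : ℂ) : SubgaussianGrowth fun _ => c := fun ε hε => by
  refine IsBigO.of_bound ‖c‖ (Eventually.of_forall fun z => ?_)
  rw [Real.norm_of_nonneg (Real.exp_pos _).le]
  exact le_mul_of_one_le_right (norm_nonneg c) (Real.one_le_exp (by positivity))

theorem exp_mul (c : ℂ) : SubgaussianGrowth fun z => Complex.exp (c * z) := fun ε hε => by
  refine IsBigO.of_bound 1 ?_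
  filter_upwards [(tendsto_norm_cocompact_atTop (E := ℂ)).eventually_ge_atTop (‖c‖ / ε)] with z hz
  rw [Real.norm_of_nonneg (Real.exp_pos _).le, one_mul, Complex.norm_exp]
  refine Real.exp_le_exp.mpr ((Complex.re_le_norm _).trans ?_)
  rw [div_le_iff₀ hε] at hz
  rw [norm_mul]
  nlinarith [norm_nonneg z]

theorem id : SubgaussianGrowth fun z => z := fun ε hε => by
  refine IsBigO.of_bound 1 ?_
  filter_upwards [(tendsto_norm_cocompact_atTop (E := ℂ)).eventually_ge_atTop (1 / ε)] with z hz
  rw [Real.norm_of_nonneg (Real.exp_pos _).le, one_mul]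
  refine le_trans ?_ (Real.add_one_le_exp _)
  rw [div_le_iff₀ hε] at hz
  nlinarith [norm_nonneg z]

theorem polynomial (P : ℂ[X]) : SubgaussianGrowth fun z => P.eval z := by
  induction P using Polynomial.induction_on' with
  | add p q hp hq => simpa using hp.add hq
  | monomial n a =>
    simp only [eval_monomial]
    refine (const a).mul ?_
    induction n with
    | zero => simpa using const 1
    | succ n ih => simpa only [pow_succ] using ih.mul id

/-- A global bound extracted from the asymptotic one. -/
theorem exists_bound (hg : SubgaussianGrowth g) (hc : Continuous g) {ε : ℝ} (hε : 0 < ε) :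
    ∃ A : ℝ, 0 < A ∧ ∀ z, ‖g z‖ ≤ A * Real.exp (ε * ‖z‖ ^ 2) := by
  obtain ⟨c, hcpos, hb⟩ := (hg ε hε).exists_pos
  rw [isBigOWith_iff] at hb
  obtain ⟨K, hK, hKc⟩ := mem_cocompact.mp hb
  obtain ⟨B, hB⟩ := hK.exists_bound_of_continuousOn hc.continuousOn
  refine ⟨max c B, lt_max_of_lt_left hcpos, fun z => ?_⟩
  have h1 : 1 ≤ Real.exp (ε * ‖z‖ ^ 2) := Real.one_le_exp (by positivity)
  by_cases hz : z ∈ K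
  · refine (hB z hz).trans ((le_max_right c B).trans ?_)
    exact le_mul_of_one_le_right (hcpos.le.trans (le_max_left _ _)) h1
  · have := hKc hz
    simp only [Set.mem_ofPred_eq, Real.norm_of_nonneg (Real.exp_pos _).le] at this
    exact this.trans (by gcongr; exact le_max_left _ _)

theorem deriv (hg : SubgaussianGrowth g) (hd : Differentiable ℂ g) :
    SubgaussianGrowth (deriv g) := fun ε hε => by
  -- Cauchy's estimate on the unit circle about `z`: there `‖w‖ ≤ 2‖z‖`, and squaring costs a factor
  -- 4.
  obtain ⟨A, hA, hb⟩ := hg.exists_bound hd.continuous (ε := ε / 4) (by positivity)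
  refine IsBigO.of_bound A ?_
  filter_upwards [(tendsto_norm_cocompact_atTop (E := ℂ)).eventually_ge_atTop 1] with z hz
  rw [Real.norm_of_nonneg (Real.exp_pos _).le]
  have := Complex.norm_deriv_le_of_forall_mem_sphere_norm_le (f := g) (c := z) (R := 1)
    (C := A * Real.exp (ε * ‖z‖ ^ 2)) one_pos hd.diffContOnCl fun w hw => ?_
  · simpa using this
  · refine (hb w).trans ?_
    have hw' : ‖w‖ ≤ 2 * ‖z‖ := by
      have h1 : ‖w - z‖ = 1 := by simpa [dist_eq_norm] using hw
      have := norm_le_norm_add_norm_sub' w z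
      linarith
    gcongr A * Real.exp ?_
    nlinarith [norm_nonneg w, norm_nonneg z, mul_self_le_mul_self (norm_nonneg w) hw']

end SubgaussianGrowth
theorem SubgaussianGrowth.of_entireOrder_le_one {f : ℂ → ℂ} (hf : Continuous f)
    (hord : entireOrder f ≤ 1) : SubgaussianGrowth f := fun ε hε => by
  -- Any exponent strictly between 1 and 2 would do.
  have hlt : entireOrder f < ((3 / 2 : ℝ) : EReal) :=
    hord.trans_lt (by exact_mod_cast (by norm_num : (1 : ℝ) < 3 / 2))
  have hev := eventually_lt_of_limsup_lt hlt
  have hpow : ∀ᶠ r : ℝ in atTop, r ^ (-(1 / 2) : ℝ) ≤ ε :=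
    (tendsto_rpow_neg_atTop (by norm_num)).eventually_le_const hε
  refine IsBigO.of_bound 1 ?_
  filter_upwards [(tendsto_norm_cocompact_atTop (E := ℂ)).eventually
    (hev.and (hpow.and (eventually_ge_atTop 2)))] with z hz
  obtain ⟨h1, h2, h3⟩ := hz
  set r := ‖z‖
  have hr : 0 < r := by linarith
  have hlog : 0 < Real.log r := Real.log_pos (by linarith)
  rw [EReal.coe_lt_coe_iff, div_lt_iff₀ hlog] at h1
  set M := maxModulus f r
  have hzM : ‖f z‖ ≤ M :=
    le_csSup ((isCompact_sphere (0 : ℂ) r).image (by fun_prop)).bddAbove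
      ⟨z, by simp [r], rfl⟩
  -- True for every real `x` by the default values of `Real.log`, so small `M` needs no separate
  -- case.
  have hle : ∀ x : ℝ, x ≤ Real.exp (Real.log x) := Real.le_exp_log
  have h4 : M ≤ Real.exp (r ^ (3 / 2 : ℝ)) := by
    refine (hle M).trans (Real.exp_le_exp.mpr ((hle _).trans ?_))
    rw [Real.rpow_def_of_pos hr, mul_comm (Real.log r)]
    exact Real.exp_le_exp.mpr h1.le
  rw [Real.norm_of_nonneg (Real.exp_pos _).le, one_mul]
  refine hzM.trans (h4.trans (Real.exp_le_exp.mpr ?_))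
  rw [show (3 / 2 : ℝ) = -(1 / 2) + 2 by norm_num, Real.rpow_add hr, Real.rpow_two]
  gcongr

/-- The growth bounds `Re k` by `ε|z|² + O(1)`; Borel–Carathéodory transfers this to `|k|`, and
Cauchy's estimate then gives `k'' = 0`. -/
theorem eq_linear_of_subgaussianGrowth_exp {k : ℂ → ℂ} (hk : Differentiable ℂ k)
    (hgr : SubgaussianGrowth fun z => Complex.exp (k z)) :
    ∃ α β : ℂ, ∀ z, k z = α * z + β := by
  have key : ∀ c, iteratedDeriv 2 k c = 0 := fun c => by
    -- Cauchy's bound is `2!(2M + 3‖k 0‖) / R²`. The part `16εR²` of `M` contributes `64ε`, the rest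
    -- `D / R² ≤ ε`.
    suffices H : ∀ ε : ℝ, 0 < ε → ‖iteratedDeriv 2 k c‖ ≤ 65 * ε by
      refine norm_le_zero_iff.mp (le_of_forall_pos_le_add fun ε hε => ?_)
      have := H (ε / 65) (by positivity)
      linarith
    intro ε hε
    obtain ⟨A, hA, hb⟩ := hgr.exists_bound hk.continuous.cexp hε
    have hre : ∀ z, (k z).re ≤ Real.log A + ε * ‖z‖ ^ 2 := fun z => by
      have := hb z
      rw [Complex.norm_exp] at this
      rw [← Real.exp_le_exp, Real.exp_add, Real.exp_log hA]
      exact this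
    set D : ℝ := 2 * (2 * (|Real.log A| + 1) + 3 * ‖k 0‖)
    have hD : 0 ≤ D := by positivity
    set R : ℝ := ‖c‖ + 1 + D / ε
    have hcR : ‖c‖ ≤ R := by
      have : 0 ≤ D / ε := by positivity
      simp only [R]; linarith
    have hR1 : 1 ≤ R := by
      have : 0 ≤ D / ε := by positivity
      simp only [R]; linarith [norm_nonneg c]
    have hDR : D ≤ ε * R := by
      have : D / ε ≤ R := by simp only [R]; linarith [norm_nonneg c]
      rwa [div_le_iff₀' hε] at this
    have hR : 0 < R := by linarith
    set M : ℝ := |Real.log A| + 1 + 16 * ε * R ^ 2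
    have hM : 0 < M := by positivity
    have hsph : ∀ z ∈ Metric.sphere c R, ‖k z‖ ≤ 2 * M + 3 * ‖k 0‖ := fun z hz => by
      have hz2 : ‖z‖ ≤ 2 * R := by
        have h1 : ‖z - c‖ = R := by simpa [dist_eq_norm] using hz
        have := norm_le_norm_add_norm_sub' z c
        linarith
      have hmap : Set.MapsTo k (Metric.ball 0 (4 * R)) {z | z.re ≤ M} := fun w hw => by
        have hw' : ‖w‖ ≤ 4 * R := (mem_ball_zero_iff.mp hw).le
        have := mul_self_le_mul_self (norm_nonneg w) hw'
        have h2 : ε * ‖w‖ ^ 2 ≤ ε * (16 * R ^ 2) := by gcongr; nlinarith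
        have := hre w
        have := le_abs_self (Real.log A)
        simp only [Set.mem_ofPred_eq, M]
        linarith
      have hbc := Complex.borelCaratheodory hM hk.differentiableOn hmap (by positivity)
        (z := z) (mem_ball_zero_iff.mpr (by linarith))
      have hpos : 0 < 4 * R - ‖z‖ := by linarith
      have e1 : 2 * M * ‖z‖ / (4 * R - ‖z‖) ≤ 2 * M := by
        rw [div_le_iff₀ hpos]
        gcongr
        linarith
      have e2 : ‖k 0‖ * (4 * R + ‖z‖) / (4 * R - ‖z‖) ≤ 3 * ‖k 0‖ := by
        rw [div_le_iff₀ hpos]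
        nlinarith [norm_nonneg (k 0)]
      linarith
    have hc := Complex.norm_iteratedDeriv_le_of_forall_mem_sphere_norm_le 2 hR
      hk.diffContOnCl hsph
    refine hc.trans ?_
    rw [div_le_iff₀ (by positivity)]
    have : D ≤ ε * R ^ 2 := hDR.trans (by gcongr; nlinarith)
    simp only [D, M] at this ⊢
    norm_num [Nat.factorial]
    linarith
  have h2 : ∀ z, deriv (deriv k) z = 0 := fun z => by
    simpa [iteratedDeriv_succ, iteratedDeriv_one] using key z
  have h1 : ∀ z, deriv k z = deriv k 0 := fun z => is_const_of_deriv_eq_zero hk.deriv h2 z 0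
  refine ⟨deriv k 0, k 0, fun z => ?_⟩
  have := is_const_of_deriv_eq_zero (f := fun z => k z - deriv k 0 * z)
    (hk.sub (by fun_prop)) (fun z => ?_) z 0
  · simp only [mul_zero, sub_zero] at this
    rw [← this]
    ring
  · have := (hk z).hasDerivAt.sub ((hasDerivAt_id z).const_mul (deriv k 0))
    refine this.deriv.trans ?_
    rw [h1 z]
    ring

/-- Hadamard factorization for finitely many zeros and growth below order two, type zero. -/
theorem exists_eq_polynomial_mul_exp {g : ℂ → ℂ} (hg : Differentiable ℂ g)
    (hgr : SubgaussianGrowth g) (hfin : {z | g z = 0}.Finite) :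
    ∃ (P : ℂ[X]) (l : ℂ), P ≠ 0 ∧ ∀ z, g z = P.eval z * Complex.exp (l * z) := by
  obtain ⟨P, h, hP, hh, h0, hgh⟩ := exists_eq_monic_mul_of_finite_zeros hg hfin
  -- Near infinity, dividing by the monic `P` does not increase the modulus, so `h` inherits the
  -- growth of `g`.
  have hP1 : ∀ᶠ z in cocompact ℂ, 1 ≤ ‖P.eval z‖ := by
    by_cases hdeg : 0 < P.degree
    · exact (P.tendsto_norm_atTop hdeg tendsto_norm_cocompact_atTop).eventually_ge_atTop 1
    · have : P = 1 := hP.natDegree_eq_zero.mp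
        (natDegree_eq_zero_iff_degree_le_zero.mpr (not_lt.mp hdeg))
      simp [this]
  have hhg : h =O[cocompact ℂ] g := by
    refine IsBigO.of_bound 1 ?_
    filter_upwards [hP1] with z hz
    rw [hgh, norm_mul, one_mul]
    exact le_mul_of_one_le_left (norm_nonneg _) hz
  obtain ⟨k, hk, hhk⟩ := exists_eq_exp hh h0
  obtain ⟨α, β, hαβ⟩ := eq_linear_of_subgaussianGrowth_exp hk
    (fun ε hε => by simpa only [← hhk] using hhg.trans (hgr ε hε))
  refine ⟨C (Complex.exp β) * P, α,
    mul_ne_zero (C_ne_zero.mpr (Complex.exp_ne_zero β)) hP.ne_zero, fun z => ?_⟩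
  rw [hgh, hhk, hαβ, Complex.exp_add]
  simp only [eval_mul, eval_C]
  ring

/-! ### Exponential polynomials. -/

/-- Along the period `2πi / l` the exponential is constant, so `e^{lz} p = q` as polynomials for
each fixed `z`; `z = 0` and `z = πi / l` then give `1 = -1`. -/
theorem eq_zero_of_polynomial_mul_exp_eq_polynomial {p q : ℂ[X]} (hp : p ≠ 0) {l : ℂ}
    (h : ∀ z, p.eval z * Complex.exp (l * z) = q.eval z) : l = 0 := by
  by_contra hl
  have hperiod : ∀ (z : ℂ) (n : ℕ), p.eval (z + n * (2 * Real.pi * Complex.I / l)) *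
      Complex.exp (l * z) = q.eval (z + n * (2 * Real.pi * Complex.I / l)) := fun z n => by
    rw [← h, mul_add, show l * (n * (2 * Real.pi * Complex.I / l)) =
      n * (2 * Real.pi * Complex.I) by field_simp, Complex.exp_add,
      Complex.exp_nat_mul_two_pi_mul_I, mul_one]
  have hinj : ∀ z : ℂ,
      Function.Injective fun n : ℕ => z + n * (2 * Real.pi * Complex.I / l) := fun z m n hmn => by
    have hT : (2 * Real.pi * Complex.I / l : ℂ) ≠ 0 := div_ne_zero Complex.two_pi_I_ne_zero hl
    exact_mod_cast mul_right_cancel₀ hT (add_left_cancel hmn)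
  have hpq : ∀ z : ℂ, p * C (Complex.exp (l * z)) = q := fun z => by
    refine eq_of_infinite_eval_eq _ _ ((Set.infinite_range_of_injective (hinj z)).mono ?_)
    rintro _ ⟨n, rfl⟩
    simpa using hperiod z n
  have h1 := (hpq 0).trans (hpq (Real.pi * Complex.I / l)).symm
  have h2 := C_injective (mul_left_cancel₀ hp h1)
  rw [mul_zero, Complex.exp_zero, mul_div_cancel₀ _ hl, Complex.exp_pi_mul_I] at h2
  norm_num at h2

theorem hasDerivAt_polynomial_mul_exp (P : ℂ[X]) (l z : ℂ) :
    HasDerivAt (fun z => P.eval z * Complex.exp (l * z))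
      ((derivative P + C l * P).eval z * Complex.exp (l * z)) z := by
  have h := (P.hasDerivAt z).mul (((hasDerivAt_id z).const_mul l).cexp)
  refine h.congr_deriv ?_
  simp only [_root_.id, eval_add, eval_mul, eval_C, mul_one]
  ring

theorem derivative_mul_add_ne_zero {L Q : ℂ[X]} (hL : L ≠ 0) (hQ : Q ≠ 0) {l : ℂ} (hl : l ≠ 0) :
    L * (derivative Q + C l * Q) - derivative L * Q ≠ 0 := fun h => by
  have e : derivative L * Q - L * derivative Q = C l * (L * Q) := by linear_combination -h
  have hLb : L.degree ≠ ⊥ := degree_ne_bot.mpr hL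
  have hQb : Q.degree ≠ ⊥ := degree_ne_bot.mpr hQ
  have d1 : (derivative L * Q).degree < (L * Q).degree := by
    rw [degree_mul, degree_mul]
    exact WithBot.add_lt_add_right hQb (degree_derivative_lt hL)
  have d2 : (L * derivative Q).degree < (L * Q).degree := by
    rw [degree_mul, degree_mul]
    exact WithBot.add_lt_add_left hLb (degree_derivative_lt hQ)
  have d3 := (degree_sub_le _ _).trans_lt (max_lt d1 d2)
  rw [e, degree_C_mul hl] at d3
  exact lt_irrefl _ d3

theorem infinite_zeros_polynomial_mul_exp_add {Q L : ℂ[X]} (hQ : Q ≠ 0) (hL : L ≠ 0) {l : ℂ}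
    (hl : l ≠ 0) : {z : ℂ | Q.eval z * Complex.exp (l * z) + L.eval z = 0}.Infinite := by
  intro hfin
  have hF : ∀ z, HasDerivAt (fun z => Q.eval z * Complex.exp (l * z) + L.eval z)
      ((derivative Q + C l * Q).eval z * Complex.exp (l * z) + (derivative L).eval z) z :=
    fun z => (hasDerivAt_polynomial_mul_exp Q l z).add (L.hasDerivAt z)
  obtain ⟨R, m, -, hR⟩ := exists_eq_polynomial_mul_exp (fun z => (hF z).differentiableAt)
    (((SubgaussianGrowth.polynomial Q).mul (.exp_mul l)).add (.polynomial L)) hfin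
  have hR' : ∀ z, (derivative Q + C l * Q).eval z * Complex.exp (l * z) + (derivative L).eval z =
      (derivative R + C m * R).eval z * Complex.exp (m * z) := fun z =>
    (hF z).unique (by simpa only [← hR] using hasDerivAt_polynomial_mul_exp R m z)
  -- With `F = Q e^{lz} + L = R e^{mz}`, the combination `L F' - L' F` removes the pure polynomial
  -- term and leaves a relation between `e^{lz}` and `e^{mz}` alone.
  have hlm : l = m := by
    refine sub_eq_zero.mp (eq_zero_of_polynomial_mul_exp_eq_polynomial
      (derivative_mul_add_ne_zero hL hQ hl)
      (q := L * (derivative R + C m * R) - derivative L * R) fun z => ?_)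
    refine mul_right_cancel₀ (Complex.exp_ne_zero (m * z)) ?_
    rw [mul_assoc, ← Complex.exp_add, show (l - m) * z + m * z = l * z by ring]
    have e1 := hR z
    have e2 := hR' z
    simp only [eval_add, eval_sub, eval_mul, eval_C] at e1 e2 ⊢
    linear_combination L.eval z * e2 - (derivative L).eval z * e1
  subst hlm
  have hRQ : ∀ z, (R - Q).eval z * Complex.exp (l * z) = L.eval z := fun z => by
    rw [eval_sub]
    linear_combination -hR z
  refine hl (eq_zero_of_polynomial_mul_exp_eq_polynomial (fun h0 => hL ?_) hRQ)
  refine Polynomial.funext fun z => ?_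
  rw [← hRQ, h0]
  simp

theorem exists_derivative_eq (P : ℂ[X]) : ∃ Q : ℂ[X], derivative Q = P := by
  induction P using Polynomial.induction_on' with
  | add p q hp hq =>
    obtain ⟨p', rfl⟩ := hp
    obtain ⟨q', rfl⟩ := hq
    exact ⟨p' + q', derivative_add⟩
  | monomial n a =>
    refine ⟨monomial (n + 1) (a / (n + 1)), ?_⟩
    have : (n + 1 : ℂ) ≠ 0 := Nat.cast_add_one_ne_zero n
    rw [derivative_monomial]
    simp [this]

/-- For `l ≠ 0`, if `Q` solves the equation for `P'`, then `l⁻¹(P - Q)` solves it for `P`. The case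
`l = 0` is included because `l ≠ 0` is deduced only after `f` has been integrated. -/
theorem exists_derivative_add_C_mul_eq (P : ℂ[X]) (l : ℂ) :
    ∃ Q : ℂ[X], derivative Q + C l * Q = P := by
  by_cases hl : l = 0
  · simpa [hl] using exists_derivative_eq P
  suffices H : ∀ (n : ℕ) (P : ℂ[X]), P.natDegree < n → ∃ Q : ℂ[X], derivative Q + C l * Q = P from
    H _ P (Nat.lt_succ_self _)
  intro n
  have hll : (C l * C l⁻¹ : ℂ[X]) = 1 := by rw [← C_mul, mul_inv_cancel₀ hl, C_1]
  induction n with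
  | zero => simp
  | succ n ih =>
    intro P hP
    by_cases h0 : P.natDegree = 0
    · refine ⟨C l⁻¹ * P, ?_⟩
      rw [derivative_C_mul, derivative_of_natDegree_zero h0]
      linear_combination P * hll
    · obtain ⟨Q, hQ⟩ := ih (derivative P) ((natDegree_derivative_lt h0).trans_le (by omega))
      refine ⟨C l⁻¹ * (P - Q), ?_⟩
      rw [derivative_C_mul, derivative_sub]
      linear_combination (-C l⁻¹) * hQ + P * hll

theorem degree_derivative_add_C_mul {P : ℂ[X]} (hP : P ≠ 0) {l : ℂ} (hl : l ≠ 0) :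
    (derivative P + C l * P).degree = P.degree := by
  rw [degree_add_eq_right_of_degree_lt, degree_C_mul hl]
  rw [degree_C_mul hl]
  exact degree_derivative_lt hP

/-! ### The two parts of the theorem. -/

theorem infinite_deriv_eq_of_deriv_mem_finite {f : ℂ → ℂ} (hf : IsTranscendentalEntire f)
    (hgr : SubgaussianGrowth f) {b : ℂ} {S : Set ℂ} (hS : S.Finite)
    (hfS : ∀ z, f z = b → deriv f z ∈ S) {c : ℂ} (hc : c ≠ 0) :
    {z : ℂ | deriv f z = c}.Infinite := by
  intro hfin
  obtain ⟨hd, htr⟩ := hf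
  obtain ⟨P, l, hP, hPl⟩ := exists_eq_polynomial_mul_exp (g := fun z => deriv f z - c)
    (hd.deriv.sub_const c) ((hgr.deriv hd).sub (.const c)) (by simpa only [sub_eq_zero] using hfin)
  obtain ⟨Q, hQ⟩ := exists_derivative_add_C_mul_eq P l
  obtain ⟨d, hfd⟩ : ∃ d, ∀ z, f z = c * z + d + Q.eval z * Complex.exp (l * z) := by
    have hder : ∀ z, HasDerivAt (fun z => f z - c * z - Q.eval z * Complex.exp (l * z)) 0 z :=
      fun z => by
        refine (((hd z).hasDerivAt.sub ((hasDerivAt_id z).const_mul c)).sub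
          (hasDerivAt_polynomial_mul_exp Q l z)).congr_deriv ?_
        rw [hQ, ← hPl]
        ring
    refine ⟨f 0 - c * 0 - Q.eval 0 * Complex.exp (l * 0), fun z => ?_⟩
    have := is_const_of_deriv_eq_zero (fun z => (hder z).differentiableAt)
      (fun z => (hder z).deriv) z 0
    linear_combination this
  have hl : l ≠ 0 := fun hl => htr ⟨C c * X + C d + Q, fun z => by simp [hfd, hl]⟩
  have hQ0 : Q ≠ 0 := by
    rintro rfl
    exact hP (by simpa using hQ.symm)
  set L : ℂ[X] := C c * X + C (d - b)
  have hL1 : L.degree = 1 := degree_linear hc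
  have hL : L ≠ 0 := fun h => by simp [h] at hL1
  have hinf := infinite_zeros_polynomial_mul_exp_add hQ0 hL hl
  obtain ⟨s, -, hs⟩ : ∃ s ∈ S, {z | Q.eval z * Complex.exp (l * z) + L.eval z = 0 ∧
      deriv f z = s}.Infinite := by
    by_contra! hcon
    refine hinf ((hS.biUnion fun s hs => hcon s hs).subset fun z hz => ?_)
    have hz0 : Q.eval z * Complex.exp (l * z) + L.eval z = 0 := hz
    have hzb : f z = b := by
      simp only [L, eval_add, eval_mul, eval_C, eval_X] at hz0
      rw [hfd]
      linear_combination hz0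
    exact Set.mem_biUnion (hfS z hzb) ⟨hz0, rfl⟩
  have hpoly : P * L = C (c - s) * Q := by
    refine eq_of_infinite_eval_eq _ _ (hs.mono ?_)
    rintro z ⟨hz, rfl⟩
    simp only [Set.mem_ofPred_eq, eval_mul, eval_C]
    linear_combination P.eval z * hz + Q.eval z * hPl z
  have hPQ : P.degree = Q.degree := by rw [← hQ, degree_derivative_add_C_mul hQ0 hl]
  -- Only an inequality, since `c - s` may vanish.
  have hle : (P * L).degree ≤ Q.degree := by
    rw [hpoly, ← smul_eq_C_mul]
    exact degree_smul_le _ _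
  rw [degree_mul, hL1, hPQ, degree_eq_natDegree hQ0] at hle
  norm_cast at hle
  omega

theorem eq_mul_exp_add_of_finite_fiber {f : ℂ → ℂ} (hf : IsTranscendentalEntire f)
    (hgr : SubgaussianGrowth f) {a b : ℂ} (hb : b ≠ 0) (hfb : ∀ z, deriv f z = b → f z = b)
    (hfin : {z : ℂ | f z = a}.Finite) :
    a ≠ b ∧ ∃ A : ℂ, A ≠ 0 ∧ ∀ z, f z = A * Complex.exp (b / (b - a) * z) + a := by
  obtain ⟨hd, htr⟩ := hf
  obtain ⟨P, l, hP, hPl⟩ := exists_eq_polynomial_mul_exp (g := fun z => f z - a)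
    (hd.sub_const a) (hgr.sub (.const a)) (by simpa only [sub_eq_zero] using hfin)
  have hl : l ≠ 0 := fun hl => htr ⟨P + C a, fun z => by
    simpa [hl] using eq_add_of_sub_eq (hPl z)⟩
  have hder : ∀ z, deriv f z = (derivative P + C l * P).eval z * Complex.exp (l * z) := fun z => by
    rw [← (hasDerivAt_polynomial_mul_exp P l z).deriv, ← deriv_sub_const a]
    simp only [hPl]
  have hP1 : derivative P + C l * P ≠ 0 := fun h => by
    have := degree_derivative_add_C_mul hP hl
    rw [h, degree_zero, eq_comm, degree_eq_bot] at this
    exact hP this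
  have hpoly : C (b - a) * (derivative P + C l * P) = C b * P := by
    refine eq_of_infinite_eval_eq _ _ ((infinite_zeros_polynomial_mul_exp_add hP1
      (C_ne_zero.mpr (neg_ne_zero.mpr hb)) hl).mono fun z hz => ?_)
    rw [Set.mem_ofPred_eq, ← hder, eval_C, add_neg_eq_zero] at hz
    have h1 := hPl z
    have h2 := hder z
    rw [hfb z hz] at h1
    rw [hz] at h2
    rw [Set.mem_ofPred_eq, eval_mul, eval_mul, eval_C, eval_C]
    linear_combination (derivative P + C l * P).eval z * h1 - P.eval z * h2
  have hab : b - a ≠ 0 := fun h => by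
    rw [h, C_0, zero_mul, eq_comm, mul_eq_zero] at hpoly
    exact hpoly.elim (C_ne_zero.mpr hb) hP
  have hpoly2 : C (b - a) * derivative P = C (b - (b - a) * l) * P := by
    rw [show C (b - (b - a) * l) = C b - C (b - a) * C l by rw [← C_mul, ← C_sub]]
    linear_combination hpoly
  -- Otherwise `P'` would have the same degree as `P`.
  have hl2 : b - (b - a) * l = 0 := by
    by_contra hne
    have := congrArg degree hpoly2
    rw [degree_C_mul hab, degree_C_mul hne] at this
    exact (degree_derivative_lt hP).ne this
  have hP' : derivative P = 0 := by
    rw [hl2, C_0, zero_mul] at hpoly2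
    exact (mul_eq_zero.mp hpoly2).resolve_left (C_ne_zero.mpr hab)
  obtain ⟨A, rfl⟩ : ∃ A, P = C A :=
    ⟨_, eq_C_of_natDegree_eq_zero (derivative_eq_zero.mp hP')⟩
  refine ⟨fun h => hab (by rw [h, sub_self]), A, C_ne_zero.mp hP, fun z => ?_⟩
  rw [show b / (b - a) = l by rw [div_eq_iff hab]; linear_combination hl2]
  simpa using eq_add_of_sub_eq (hPl z)

theorem lemma2p5 (f : ℂ → ℂ) (hf : IsTranscendentalEntire f) (hord : entireOrder f ≤ 1)
    (b : ℂ) (hb : b ≠ 0) :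
    (∀ S : Set ℂ, S.Finite → (∀ z, f z = b → deriv f z ∈ S) →
      ∀ c : ℂ, c ≠ 0 → {z : ℂ | deriv f z = c}.Infinite) ∧
    ((∀ z, deriv f z = b → f z = b) →
      ∀ a : ℂ, {z : ℂ | f z = a}.Finite →
        a ≠ b ∧ ∃ C : ℂ, C ≠ 0 ∧ ∀ z, f z = C * Complex.exp (b / (b - a) * z) + a) := by
  have hgr : SubgaussianGrowth f := .of_entireOrder_le_one hf.1.continuous hord
  exact ⟨fun S hS hfS c hc => infinite_deriv_eq_of_deriv_mem_finite hf hgr hS hfS hc,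
    fun hfb a hfin => eq_mul_exp_add_of_finite_fiber hf hgr hb hfb hfin⟩
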